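/- Conventions. All vector spaces are real. A Banach scale (sc-Banach space) is a Banach space $E=E_0$ together with a nested sequence of linear subspaces $E=E_0\supset E_1\supset E_2\supset\dots$, called levels, such that each $E_m$ is a Banach space with respect to a norm $|\cdot|_m$ of its own (where $|\cdot|_0$ is the norm of $E$), each inclusion $E_{m+1}\hookrightarrow E_m$ is a compact linear operator, and $E_\infty:=\bigcap_{m\ge 0}E_m$ is dense in every $E_m$. An sc-subspace of $E$ is a closed linear subspace $A\subset E$ for which the levels $A_m:=A\cap E_m$, with the norms $|\cdot|_m$, form a Banach scale. An sc-splitting $E=A\oplus B$ is a pair of sc-subspaces $A,B$ of $E$ with $E_m=A_m\oplus B_m$ for every $m\ge 0$. For Banach scales $E,F$, an sc-operator $T:E\to F$ is a linear operator with $T(E_m)\subset F_m$ for which $T|_{E_m}:E_m\to F_m$ is continuous, for every $m\ge 0$. An sc-isomorphism is a bijective sc-operator whose inverse also maps level $m$ into level $m$ for every $m$. An $\mathrm{sc}^+$-operator $S:E\to F$ is a linear operator that is an sc-operator $E\to F^1$, where $F^1$ is the Banach scale with levels $(F^1)_m:=F_{m+1}$. An sc-operator $T:E\to F$ is sc-Fredholm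 if there are sc-splittings $E=K\oplus X$ and $F=Y\oplus C$ such that $K=\ker T$ and $K$ is finite dimensional, $Y=\operatorname{im}T$ and $C$ is finite dimensional, and $T$ viewed as a map $X\to Y$ is an sc-isomorphism. Its Fredholm index is $\operatorname{index}T:=\dim K-\dim C=\dim\ker T-\operatorname{codim}\operatorname{im}T\in\mathbb{Z}$. Proposition (stability of the sc-Fredholm property). Let $E$ and $F$ be Banach scales, let $T:E\to F$ be an sc-Fredholm operator and let $S:E\to F$ be an $\mathrm{sc}^+$-operator. Then $T+S:E\to F$ is an sc-Fredholm operator, and $\operatorname{index}(T+S)=\operatorname{index}T$. -/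

import Mathlib

noncomputable section

universe u v

/-- A nested sequence `level 0 ⊇ level 1 ⊇ ...` of real linear spaces, each with its own norm.
The levels are subspaces of one vector space `V`, which plays no other role: the space carrying
the scale structure is the top level `E = E₀ = level 0`, with its norm `norm 0`. -/
structure NormedScale (V : Type u) [AddCommGroup V] [Module ℝ V] where
  /-- The levels `E_m`. -/
  level : ℕ → Submodule ℝ V
  level_succ_le : ∀ m, level (m + 1) ≤ level m
  /-- The norm `|·|_m` of the level `E_m`; it is unrelated to the norms of the other levels. -/
  norm : ∀ m, Seminorm ℝ (level m)
  eq_zero_of_norm_eq_zero : ∀ m x, norm m x = 0 → x = 0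

namespace NormedScale

variable {V : Type u} [AddCommGroup V] [Module ℝ V] {W : Type v} [AddCommGroup W] [Module ℝ W]

theorem level_le (E : NormedScale V) {k m : ℕ} (h : k ≤ m) : E.level m ≤ E.level k :=
  antitone_nat_of_succ_le E.level_succ_le h

/-- The level `E_m` as a normed space of its own. -/
def Level (E : NormedScale V) (m : ℕ) : Type u := E.level m

instance (E : NormedScale V) (m : ℕ) : NormedAddCommGroup (E.Level m) :=
  AddGroupNorm.toNormedAddCommGroup (E := E.level m)
    { (E.norm m).toAddGroupSeminorm with
      eq_zero_of_map_eq_zero' := E.eq_zero_of_norm_eq_zero m }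

instance (E : NormedScale V) (m : ℕ) : NormedSpace ℝ (E.Level m) :=
  { (inferInstance : Module ℝ (E.level m)) with
    norm_smul_le := fun c x => (map_smul_eq_mul (E.norm m) c x).le }

/-- The inclusion of the level `E_m` in the ambient vector space. -/
def toAmbient (E : NormedScale V) (m : ℕ) : E.Level m →ₗ[ℝ] V := (E.level m).subtype

/-- The inclusion operator `E_m → E_k` for `k ≤ m`. -/
def incl (E : NormedScale V) {k m : ℕ} (h : k ≤ m) : E.Level m →ₗ[ℝ] E.Level k :=
  Submodule.inclusion (E.level_le h)

/-- The smooth points `E_∞ = ⋂ E_m`. -/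
def smooth (E : NormedScale V) : Submodule ℝ V := ⨅ m, E.level m

/-- The axioms of a Banach scale (sc-Banach space). -/
structure IsBanachScale (E : NormedScale V) : Prop where
  banach_levels : ∀ m, CompleteSpace (E.Level m)
  compactness : ∀ m, IsCompactOperator (E.incl (Nat.le_succ m))
  density : ∀ m, Dense {x : E.Level m | E.toAmbient m x ∈ E.smooth}

/-- The shifted scale `E^k`, with levels `(E^k)_m = E_{k+m}`. -/
def shift (E : NormedScale V) (k : ℕ) : NormedScale V where
  level m := E.level (k + m)
  level_succ_le m := E.level_succ_le (k + m)
  norm m := E.norm (k + m)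
  eq_zero_of_norm_eq_zero m := E.eq_zero_of_norm_eq_zero (k + m)

/-- The nested sequence with levels `A_m = A ∩ E_m` that a linear subspace `A` of `E = E₀`
generates; the level `A_m` carries the norm of `E_m`. -/
def induced (E : NormedScale V) (A : Submodule ℝ (E.Level 0)) : NormedScale V where
  level m := A.map (E.toAmbient 0) ⊓ E.level m
  level_succ_le m := inf_le_inf_left _ (E.level_succ_le m)
  norm m := (E.norm m).comp (Submodule.inclusion inf_le_right)
  eq_zero_of_norm_eq_zero m x hx := by
    have h : Submodule.inclusion inf_le_right x = (0 : E.level m) :=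
      E.eq_zero_of_norm_eq_zero m _ hx
    have h' : (x : V) = 0 := congrArg Subtype.val h
    exact Subtype.ext h'

/-- An sc-subspace of `E`: a closed linear subspace of `E = E₀` whose intersections with the
levels of `E` form a Banach scale. -/
def IsScSubspace (E : NormedScale V) (A : Submodule ℝ (E.Level 0)) : Prop :=
  IsClosed (A : Set (E.Level 0)) ∧ (E.induced A).IsBanachScale

/-- An sc-splitting `E = A ⊕ B`: both summands are sc-subspaces and `E_m = A_m ⊕ B_m` for every
`m`, where `A_m = A ∩ E_m` and `B_m = B ∩ E_m`. -/
structure IsScSplitting (E : NormedScale V) (A B : Submodule ℝ (E.Level 0)) : Prop where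
  left : E.IsScSubspace A
  right : E.IsScSubspace B
  disjoint : ∀ m, (E.induced A).level m ⊓ (E.induced B).level m = ⊥
  sum : ∀ m, (E.induced A).level m ⊔ (E.induced B).level m = E.level m

/-- A linear operator `T : E → F` is level preserving if `T(E_m) ⊆ F_m` for every `m`. -/
def LevelPreserving {E : NormedScale V} {F : NormedScale W}
    (T : E.Level 0 →ₗ[ℝ] F.Level 0) : Prop :=
  ∀ (m : ℕ) (x : E.Level 0), E.toAmbient 0 x ∈ E.level m → F.toAmbient 0 (T x) ∈ F.level m

/-- The level operator `T_m = T|_{E_m} : E_m → F_m` of a level preserving operator. -/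
def levelOperator {E : NormedScale V} {F : NormedScale W} (T : E.Level 0 →ₗ[ℝ] F.Level 0)
    (hT : LevelPreserving T) (m : ℕ) : E.Level m →ₗ[ℝ] F.Level m :=
  LinearMap.codRestrict (F.level m) (F.toAmbient 0 ∘ₗ T ∘ₗ E.incl (Nat.zero_le m))
    fun x => hT m _ x.2

/-- An sc-operator `T : E → F`: a level preserving linear operator all of whose level operators
are continuous. -/
def IsScOperator {E : NormedScale V} {F : NormedScale W}
    (T : E.Level 0 →ₗ[ℝ] F.Level 0) : Prop :=
  ∃ hT : LevelPreserving T, ∀ m, Continuous (levelOperator T hT m)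

/-- An sc⁺-operator `S : E → F`: one that takes its values in `F₁` and is an sc-operator
`E → F¹`, where `F¹` is the shifted scale. -/
def IsScPlusOperator {E : NormedScale V} {F : NormedScale W}
    (S : E.Level 0 →ₗ[ℝ] F.Level 0) : Prop :=
  ∃ S' : E.Level 0 →ₗ[ℝ] (F.shift 1).Level 0, IsScOperator S' ∧
    ∀ x, F.toAmbient 0 (S x) = (F.shift 1).toAmbient 0 (S' x)

/-- A linear sc-isomorphism: a bijective sc-operator whose inverse is level preserving. -/
def IsScIsomorphism {E : NormedScale V} {F : NormedScale W}
    (Φ : E.Level 0 ≃ₗ[ℝ] F.Level 0) : Prop :=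
  IsScOperator Φ.toLinearMap ∧ LevelPreserving Φ.symm.toLinearMap

/-- An sc-Fredholm operator `T : E → F`: an sc-operator for which there are sc-splittings
`E = K ⊕ X` and `F = Y ⊕ C` such that `K = ker T` and `C` are finite dimensional, `Y = im T`, and
`T` viewed as a map `X → Y` is an sc-isomorphism of the Banach scales generated by `X`
and `Y`. -/
def IsScFredholm {E : NormedScale V} {F : NormedScale W}
    (T : E.Level 0 →ₗ[ℝ] F.Level 0) : Prop :=
  IsScOperator T ∧
  ∃ (K X : Submodule ℝ (E.Level 0)) (Y C : Submodule ℝ (F.Level 0)),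
    E.IsScSplitting K X ∧ F.IsScSplitting Y C ∧
    (K = LinearMap.ker T ∧ FiniteDimensional ℝ K) ∧
    (Y = LinearMap.range T ∧ FiniteDimensional ℝ C) ∧
    ∃ Φ : (E.induced X).Level 0 ≃ₗ[ℝ] (F.induced Y).Level 0, IsScIsomorphism Φ ∧
      ∀ (a : E.Level 0) (x : (E.induced X).Level 0),
        E.toAmbient 0 a = (E.induced X).toAmbient 0 x →
        F.toAmbient 0 (T a) = (F.induced Y).toAmbient 0 (Φ x)

/-- The Fredholm index `dim ker T - codim im T`. -/
def fredholmIndex {E : NormedScale V} {F : NormedScale W}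
    (T : E.Level 0 →ₗ[ℝ] F.Level 0) : ℤ :=
  (Module.finrank ℝ (LinearMap.ker T) : ℤ) -
    (Module.finrank ℝ (F.Level 0 ⧸ LinearMap.range T) : ℤ)

end NormedScale

end

/-!
The sc-Fredholm property is a Fredholm property of the single operator `T : E₀ → F₀` together with
a regularity property, and both survive the addition of an sc⁺-operator.

An sc-Fredholm operator is Fredholm on the level zero, and it is *regularizing*: `T x ∈ F_m`
forces `x ∈ E_m` (`IsScFredholm.mem_level`), because the inverse of `T : X → Y` preserves levels and
the finite-dimensional kernel consists of smooth points. Conversely, a regularizing sc-operator that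
is Fredholm on the level zero is sc-Fredholm (`isScFredholm_of_regularizing`): by regularity its
kernel is smooth, by density of `F_∞` its range has a complement in `F_∞`, and a finite-dimensional
space of smooth points together with any closed complement is an sc-splitting
(`IsBanachScale.isScSplitting`).

An sc⁺-operator `S` factors on the level zero through the compact inclusion `F₁ → F₀`, so `T + S` is
a compact perturbation of `T`; hence it is Fredholm of the same index
(`ContinuousLinearMap.IsFredholm.add_isCompactOperator`). Regularity of `T + S` is a bootstrap: if
`x ∈ E_m` and `(T + S) x ∈ F_{m+1}`, then `T x = (T + S) x - S x ∈ F_{m+1}`, hence `x ∈ E_{m+1}`.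

The stability of the Fredholm index under compact perturbations is reduced, by a quasi-inverse and
additivity of the index, to the perturbations `1 + R` of the identity with `R` compact. These have
index zero: a linear map from the kernel of `1 + R` to a complement of its range that is injective
or surjective gives a finite-rank operator `G` with `1 + R + G` injective or surjective, hence
bijective by the Fredholm alternative, so the kernel and the complement have the same dimension.
-/

open scoped LinearMap.FiniteRangeSetoid

/-! ### Compact perturbations of the identity of a Banach space -/

namespace IsCompactOperator

variable {X : Type*} [NormedAddCommGroup X] [NormedSpace ℝ X]

/-- A compact perturbation `1 + R` of the identity has finite-dimensional kernel, because the
identity of the kernel agrees there with the compact operator `-R`. -/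
theorem finiteDimensional_ker_one_add {R : X →L[ℝ] X} (hR : IsCompactOperator R) :
    FiniteDimensional ℝ (1 + R : X →L[ℝ] X).ker := by
  have hmem : ∀ v ∈ (1 + R : X →L[ℝ] X).ker, (-R : X →L[ℝ] X).toLinearMap v = v := by
    intro v hv
    have h : v + R v = 0 := by simpa using hv
    simpa using (eq_neg_of_add_eq_zero_left h).symm
  have hneg : IsCompactOperator (-R : X →L[ℝ] X).toLinearMap := hR.neg
  have hmaps : ∀ v ∈ (1 + R : X →L[ℝ] X).ker,
      (-R : X →L[ℝ] X).toLinearMap v ∈ (1 + R : X →L[ℝ] X).ker := fun v hv => by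
    rw [hmem v hv]; exact hv
  have h := hneg.restrict hmaps (1 + R : X →L[ℝ] X).isClosed_ker
  refine FiniteDimensional.of_isCompactOperator_id (𝕜 := ℝ) ?_
  have heq : ((-R : X →L[ℝ] X).toLinearMap.restrict hmaps :
      (1 + R : X →L[ℝ] X).ker → (1 + R : X →L[ℝ] X).ker) = id :=
    funext fun v => Subtype.ext (hmem v v.2)
  rwa [heq] at h

variable [CompleteSpace X]

/-- The Fredholm alternative: a compact perturbation of the identity that is injective is also
surjective. -/
theorem surjective_one_add_of_injective {R : X →L[ℝ] X} (hR : IsCompactOperator R)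
    (h : Function.Injective (1 + R : X →L[ℝ] X)) : Function.Surjective (1 + R : X →L[ℝ] X) := by
  -- `1 + R` is `-(-1 - R)`, so the alternative is applied to `R` at the value `-1`.
  have hnot : ¬ Module.End.HasEigenvalue (R : Module.End ℝ X) (-1) := by
    intro hev
    obtain ⟨x, hx⟩ := hev.exists_hasEigenvector
    refine hx.2 (h ?_)
    have := hx.apply_eq_smul
    simp at this
    simp [this]
  have hmem := (hR.hasEigenvalue_or_mem_resolventSet (by norm_num : (-1 : ℝ) ≠ 0)).resolve_left hnot
  rw [spectrum.mem_resolventSet_iff] at hmem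
  have hu : IsUnit (1 + R : X →L[ℝ] X) := by
    have h := hmem.neg
    have he : -((algebraMap ℝ (X →L[ℝ] X)) (-1) - R) = 1 + R := by
      rw [map_neg, map_one]; abel
    rwa [he] at h
  obtain ⟨w, hw⟩ := hu.exists_right_inv
  intro y
  exact ⟨w y, by simpa using congr($hw y)⟩

/-- The converse half of the Fredholm alternative. A continuous right inverse `B` of `1 + R`
satisfies `B = 1 - R B`, so it is an injective compact perturbation of the identity, hence
bijective, and therefore so is `1 + R`. -/
theorem injective_one_add_of_surjective {R : X →L[ℝ] X} (hR : IsCompactOperator R)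
    (h : Function.Surjective (1 + R : X →L[ℝ] X)) : Function.Injective (1 + R : X →L[ℝ] X) := by
  have := hR.finiteDimensional_ker_one_add
  obtain ⟨D, hDc, hD⟩ :=
    (Submodule.ClosedComplemented.of_finiteDimensional
      (1 + R : X →L[ℝ] X).ker).exists_isClosed_isCompl
  have := hDc.completeSpace_coe
  let r : D →L[ℝ] X := (1 + R : X →L[ℝ] X) ∘L D.subtypeL
  have hrk : r.ker = ⊥ := by
    rw [Submodule.eq_bot_iff]
    intro x hx
    exact Subtype.ext (Submodule.disjoint_def.1 hD.disjoint x hx x.2)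
  have hrr : r.range = ⊤ := by
    rw [LinearMap.range_eq_top]
    intro y
    obtain ⟨x, rfl⟩ := h y
    obtain ⟨k, hk, d, hd, rfl⟩ := Submodule.mem_sup.1 (hD.sup_eq_top ▸ Submodule.mem_top (x := x))
    refine ⟨⟨d, hd⟩, ?_⟩
    have hk' : (1 + R : X →L[ℝ] X) k = 0 := hk
    change (1 + R : X →L[ℝ] X) d = _
    rw [map_add, hk', zero_add]
  let B : X →L[ℝ] X := D.subtypeL ∘L (ContinuousLinearEquiv.ofBijective r hrk hrr).symm
  have hB : ∀ y, (1 + R : X →L[ℝ] X) (B y) = y := fun y =>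
    (ContinuousLinearEquiv.ofBijective r hrk hrr).apply_symm_apply y
  have hBR : B = 1 + (-(R ∘L B)) := by
    ext y
    have h : B y + R (B y) = y := hB y
    change B y = y + -(R (B y))
    rw [← sub_eq_add_neg]
    exact eq_sub_of_add_eq h
  have hc : IsCompactOperator (-(R ∘L B) : X →L[ℝ] X) := (hR.comp_clm B).neg
  have hinj : Function.Injective B := Function.LeftInverse.injective hB
  have hsurj : Function.Surjective B := by
    rw [hBR] at hinj ⊢
    exact hc.surjective_one_add_of_injective hinj
  intro x y hxy
  obtain ⟨x, rfl⟩ := hsurj x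
  obtain ⟨y, rfl⟩ := hsurj y
  rw [hB, hB] at hxy
  rw [hxy]

/-- Between two vector spaces, one of them finite-dimensional, there is a linear map that is
injective or surjective. -/
theorem _root_.LinearMap.exists_injective_or_surjective {K : Type*} {N : Type u} {C : Type v}
    [DivisionRing K]
    [AddCommGroup N] [Module K N] [AddCommGroup C] [Module K C] :
    ∃ J : N →ₗ[K] C, Function.Injective J ∨ Function.Surjective J := by
  rcases le_total (Cardinal.lift.{v} (Module.rank K N))
    (Cardinal.lift.{u} (Module.rank K C)) with h | h
  · obtain ⟨J, hJ⟩ := lift_rank_le_iff_exists_linearMap.1 h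
    exact ⟨J, .inl hJ⟩
  · obtain ⟨J, hJ⟩ := lift_rank_le_iff_exists_linearMap.1 h
    obtain ⟨J', hJ'⟩ := J.exists_leftInverse_of_injective (LinearMap.ker_eq_bot.2 hJ)
    exact ⟨J', .inr fun y => ⟨J y, congr($hJ' y)⟩⟩

/-- Riesz: a compact perturbation of the identity of a Banach space has finite-dimensional kernel
and cokernel, of the same dimension, and a quasi-inverse. -/
theorem exists_isQuasiInverse_one_add {R : X →L[ℝ] X} (hR : IsCompactOperator R) :
    (∃ w : X →L[ℝ] X, w.IsQuasiInverse (1 + R : X →L[ℝ] X).toLinearMap) ∧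
      (1 + R : X →L[ℝ] X).toLinearMap.index = 0 := by
  set A : X →L[ℝ] X := 1 + R with hA
  have := hR.finiteDimensional_ker_one_add
  rw [← hA] at this
  obtain ⟨D, hDc, hD⟩ :=
    (Submodule.ClosedComplemented.of_finiteDimensional A.ker).exists_isClosed_isCompl
  obtain ⟨C, hC⟩ := A.range.exists_isCompl
  obtain ⟨J, hJ⟩ := LinearMap.exists_injective_or_surjective (K := ℝ) (N := A.ker) (C := C)
  have htop : Submodule.IsTopCompl D A.ker :=
    Submodule.IsCompl.isTopCompl_of_isClosed_of_finiteDimensional hD.symm hDc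
  -- `G` carries the kernel of `A` into a complement of its range.
  let G : X →L[ℝ] X :=
    (C.subtype ∘ₗ J).toContinuousLinearMap ∘L A.ker.projectionOntoL D htop.symm
  have hG : ∀ x, G x = J (A.ker.projectionOntoL D htop.symm x) := fun _ => rfl
  have hGc : IsCompactOperator G :=
    (isCompactOperator_of_locallyCompactSpace_rng
      (C.subtype ∘ₗ J).toContinuousLinearMap).comp_clm _
  have hU : A + G = 1 + (R + G) := by rw [hA]; abel
  have hbij : Function.Bijective (A + G : X →L[ℝ] X) ∧ Function.Bijective J := by
    rcases hJ with hJ | hJ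
    · have hinj : Function.Injective (A + G : X →L[ℝ] X) := by
        rw [injective_iff_map_eq_zero]
        intro x hx
        have hx' : A x + J (A.ker.projectionOntoL D htop.symm x) = 0 := hx
        have h0 : A x = 0 := by
          refine Submodule.disjoint_def.1 hC.disjoint _ ⟨x, rfl⟩ ?_
          rw [eq_neg_of_add_eq_zero_left hx']
          exact C.neg_mem (J _).2
        rw [h0, zero_add] at hx'
        have h1 : A.ker.projectionOntoL D htop.symm x = 0 :=
          hJ (by rw [map_zero]; exact Subtype.ext hx')
        rw [Submodule.projectionOntoL_apply_eq_zero_iff] at h1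
        exact Submodule.disjoint_def.1 hD.disjoint _ h0 h1
      have hsurj : Function.Surjective (A + G : X →L[ℝ] X) := by
        rw [hU] at hinj ⊢
        exact (hR.add hGc).surjective_one_add_of_injective hinj
      refine ⟨⟨hinj, hsurj⟩, hJ, fun c => ?_⟩
      obtain ⟨x, hx⟩ := hsurj c
      refine ⟨A.ker.projectionOntoL D htop.symm x, ?_⟩
      have hx' : A x + J (A.ker.projectionOntoL D htop.symm x) = c := hx
      have h0 : A x = 0 := by
        refine Submodule.disjoint_def.1 hC.disjoint _ ⟨x, rfl⟩ ?_
        rw [eq_sub_of_add_eq hx']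
        exact C.sub_mem c.2 (J _).2
      rw [h0, zero_add] at hx'
      exact Subtype.ext hx'
    · have key : ∀ (d : X) (n : A.ker), d ∈ D → (A + G) (d + n) = A d + J n := by
        intro d n hd
        have h0 : A.ker.projectionOntoL D htop.symm d = 0 := by
          rwa [Submodule.projectionOntoL_apply_eq_zero_iff]
        have h1 : A n = 0 := n.2
        change A (d + n) + J (A.ker.projectionOntoL D htop.symm (d + n)) = _
        rw [map_add, map_add, h0, h1, Submodule.projectionOntoL_apply_left]
        simp
      have hsurj : Function.Surjective (A + G : X →L[ℝ] X) := by
        intro y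
        obtain ⟨_, ⟨x, rfl⟩, c, hc, rfl⟩ :=
          Submodule.mem_sup.1 (hC.sup_eq_top ▸ Submodule.mem_top (x := y))
        obtain ⟨k, hk, d, hd, rfl⟩ :=
          Submodule.mem_sup.1 (hD.sup_eq_top ▸ Submodule.mem_top (x := x))
        obtain ⟨n, hn⟩ := hJ ⟨c, hc⟩
        refine ⟨d + n, ?_⟩
        have hk' : A k = 0 := hk
        rw [key d n hd, hn]
        simp [hk']
      have hinj : Function.Injective (A + G : X →L[ℝ] X) := by
        rw [hU] at hsurj ⊢
        exact (hR.add hGc).injective_one_add_of_surjective hsurj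
      refine ⟨⟨hinj, hsurj⟩, ?_, hJ⟩
      rw [injective_iff_map_eq_zero]
      intro n hn
      have h := key 0 n D.zero_mem
      rw [hn] at h
      have h' : (0 : X) + (n : X) = 0 := hinj (by simpa using h)
      exact Subtype.ext (by simpa using h')
  obtain ⟨hUb, hJb⟩ := hbij
  constructor
  · let e : X ≃L[ℝ] X := ContinuousLinearEquiv.ofBijective (A + G)
      (LinearMap.ker_eq_bot.2 hUb.1) (LinearMap.range_eq_top.2 hUb.2)
    refine ⟨e.symm, ?_⟩
    have hq : LinearMap.IsQuasiInverse (e.symm : X →L[ℝ] X).toLinearMap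
        (A + G : X →L[ℝ] X).toLinearMap := e.toLinearEquiv.isQuasiInverse
    refine hq.congr (Setoid.refl _) (LinearMap.FiniteRangeSetoid.equiv_iff_hasFiniteRange.2 ?_)
    have : A.toLinearMap - (A + G : X →L[ℝ] X).toLinearMap =
      (-(C.subtype ∘ₗ J)) ∘ₗ (A.ker.projectionOntoL D htop.symm).toLinearMap := by
      ext x
      simp [hG]
    rw [this]
    exact LinearMap.HasFiniteRange.of_finite_dom.comp_right _
  · rw [LinearMap.index_eq_finrank_sub, (Submodule.quotientEquivOfIsCompl _ C hC).finrank_eq,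
      (LinearEquiv.ofBijective J hJb).finrank_eq, sub_self]

end IsCompactOperator

/-! ### Compact perturbations of Fredholm operators -/

namespace ContinuousLinearMap

variable {X Y : Type*} [NormedAddCommGroup X] [NormedSpace ℝ X]
  [NormedAddCommGroup Y] [NormedSpace ℝ Y]

/-- A continuous operator of finite rank is compact. -/
theorem isCompactOperator_of_hasFiniteRange {f : X →L[ℝ] Y}
    (hf : f.toLinearMap.HasFiniteRange) : IsCompactOperator f := by
  rw [LinearMap.hasFiniteRange_iff_range] at hf
  obtain ⟨W, hW⟩ : ∃ W : Submodule ℝ Y, W = f.range := ⟨_, rfl⟩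
  rw [← hW] at hf
  have : FiniteDimensional ℝ W := .of_fg hf
  have := FiniteDimensional.proper ℝ W
  exact (isCompactOperator_of_locallyCompactSpace_rng W.subtypeL).comp_clm
    (f.codRestrict W fun x => hW ▸ ⟨x, rfl⟩)

/-- If `v` is a quasi-inverse of `u`, then `v u` is a compact perturbation of the identity. -/
theorem isCompactOperator_comp_sub_one {u : X →L[ℝ] Y} {v : Y →L[ℝ] X}
    (h : LinearMap.IsLeftQuasiInverse v.toLinearMap u.toLinearMap) :
    IsCompactOperator (v ∘L u - 1 : X →L[ℝ] X) := by
  exact isCompactOperator_of_hasFiniteRange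
    (LinearMap.FiniteRangeSetoid.equiv_iff_hasFiniteRange.1 h)

end ContinuousLinearMap

namespace ContinuousLinearMap.IsFredholm

variable {X Y : Type*} [NormedAddCommGroup X] [NormedSpace ℝ X] [CompleteSpace X]
  [NormedAddCommGroup Y] [NormedSpace ℝ Y]

/-- Compact perturbations preserve Fredholm operators and their index. With a quasi-inverse `v` of
`u`, both `v u` and `v (u + s)` are compact perturbations of the identity, which have index zero,
so additivity of the index gives `index (u + s) = -index v = index u`. -/
theorem add_isCompactOperator {u s : X →L[ℝ] Y} (hu : u.IsFredholm) (hs : IsCompactOperator s) :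
    (u + s).IsFredholm ∧ (u + s).toLinearMap.index = u.toLinearMap.index := by
  obtain ⟨v, hv⟩ := hu.exists_isQuasiInverse
  have hleft := ContinuousLinearMap.isCompactOperator_comp_sub_one hv.1
  have hl : IsCompactOperator (v ∘L u - 1 + v ∘L s : X →L[ℝ] X) := hleft.add (hs.clm_comp v)
  have el : 1 + (v ∘L u - 1 + v ∘L s : X →L[ℝ] X) = v ∘L (u + s) := by
    rw [ContinuousLinearMap.comp_add]; abel
  have e0 : 1 + (v ∘L u - 1 : X →L[ℝ] X) = v ∘L u := by abel
  obtain ⟨⟨a, ha⟩, il⟩ := hl.exists_isQuasiInverse_one_add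
  have i0 := hleft.exists_isQuasiInverse_one_add.2
  rw [el] at ha il
  rw [e0] at i0
  have hfred : (u + s).IsFredholm := .of_isQuasiInverse (v := a ∘L v) (hv.symm.of_comp_right ha)
  refine ⟨hfred, ?_⟩
  have hvf : v.IsFredholm := .of_isQuasiInverse hv.symm
  have := hu.finite_ker; have := hu.finite_coker
  have := hvf.finite_ker; have := hvf.finite_coker
  have := hfred.finite_ker; have := hfred.finite_coker
  have c1 := LinearMap.index_comp (f := u.toLinearMap) v.toLinearMap
  have c2 := LinearMap.index_comp (f := (u + s).toLinearMap) v.toLinearMap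
  rw [ContinuousLinearMap.toLinearMap_comp] at il i0
  lia

variable [CompleteSpace Y]

/-- Between Banach spaces, an operator with finite-dimensional kernel and closed range of finite
codimension is Fredholm; strictness is the open mapping theorem. -/
theorem of_isClosed_range {u : X →L[ℝ] Y} (hker : FiniteDimensional ℝ u.ker)
    (hclosed : IsClosed (u.range : Set Y)) (hrange : u.range.CoFG) : u.IsFredholm := by
  obtain ⟨D, hDc, hD⟩ :=
    (Submodule.ClosedComplemented.of_finiteDimensional u.ker).exists_isClosed_isCompl
  have := hDc.completeSpace_coe
  have := hclosed.completeSpace_coe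
  have hDfin : D.CoFG := (Submodule.fg_iff_finiteDimensional _ |>.2 hker).cofg_of_isCompl hD
  have hmaps : Set.MapsTo u D u.range := fun x _ => ⟨x, rfl⟩
  refine .of_isInvertible_restrict hDc hclosed hmaps
    ⟨ContinuousLinearEquiv.ofBijective (u.restrict hmaps) ?_ ?_, rfl⟩
  · rw [Submodule.eq_bot_iff]
    intro x hx
    exact Subtype.ext (Submodule.disjoint_def.1 hD.disjoint x congr(($hx).val) x.2)
  · rw [LinearMap.range_eq_top]
    rintro ⟨_, x, rfl⟩
    obtain ⟨k, hk, d, hd, rfl⟩ := Submodule.mem_sup.1 (hD.sup_eq_top ▸ Submodule.mem_top (x := x))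
    refine ⟨⟨d, hd⟩, Subtype.ext ?_⟩
    have hk' : u k = 0 := hk
    change u d = u (k + d)
    rw [map_add, hk', zero_add]

end ContinuousLinearMap.IsFredholm

/-! ### Levels and induced scales -/

namespace NormedScale

variable {V : Type u} [AddCommGroup V] [Module ℝ V] {W : Type v} [AddCommGroup W] [Module ℝ W]
  {E : NormedScale V} {F : NormedScale W}

theorem toAmbient_mem (E : NormedScale V) (m : ℕ) (x : E.Level m) :
    E.toAmbient m x ∈ E.level m := x.2

theorem toAmbient_injective (E : NormedScale V) (m : ℕ) : Function.Injective (E.toAmbient m) :=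
  Subtype.val_injective

theorem exists_toAmbient_eq {m : ℕ} {v : V} (hv : v ∈ E.level m) :
    ∃ x : E.Level m, E.toAmbient m x = v := ⟨⟨v, hv⟩, rfl⟩

theorem mem_smooth {v : V} : v ∈ E.smooth ↔ ∀ m, v ∈ E.level m := Submodule.mem_iInf _

theorem mem_level_induced {A : Submodule ℝ (E.Level 0)} {m : ℕ} {v : V} :
    v ∈ (E.induced A).level m ↔ v ∈ A.map (E.toAmbient 0) ∧ v ∈ E.level m := Iff.rfl

theorem toAmbient_mem_map {A : Submodule ℝ (E.Level 0)} {x : E.Level 0} :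
    E.toAmbient 0 x ∈ A.map (E.toAmbient 0) ↔ x ∈ A :=
  (E.toAmbient_injective 0).mem_set_image

/-- The inclusions of the levels of a Banach scale in each other are continuous. -/
theorem IsBanachScale.continuous_incl (hE : E.IsBanachScale) {k m : ℕ} (h : k ≤ m) :
    Continuous (E.incl h) := by
  induction m, h using Nat.le_induction with
  | base => exact continuous_id
  | succ m h ih => exact ih.comp (hE.compactness m).continuous

/-- The isometric inclusion `A_m = A ∩ E_m → E_m`. -/
def inducedIncl (E : NormedScale V) (A : Submodule ℝ (E.Level 0)) (m : ℕ) :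
    (E.induced A).Level m →ₗᵢ[ℝ] E.Level m where
  toLinearMap := Submodule.inclusion (inf_le_right : A.map (E.toAmbient 0) ⊓ E.level m ≤ _)
  norm_map' _ := rfl

theorem range_inducedIncl (A : Submodule ℝ (E.Level 0)) (m : ℕ) :
    Set.range (E.inducedIncl A m) = E.incl (Nat.zero_le m) ⁻¹' A := by
  ext x
  constructor
  · rintro ⟨y, rfl⟩
    exact toAmbient_mem_map.1 (mem_level_induced.1 ((E.induced A).toAmbient_mem m y)).1
  · intro hx
    exact ⟨⟨E.toAmbient m x, toAmbient_mem_map.2 hx, E.toAmbient_mem m x⟩, rfl⟩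

theorem mem_smooth_induced {A : Submodule ℝ (E.Level 0)} {v : V} :
    v ∈ (E.induced A).smooth ↔ v ∈ A.map (E.toAmbient 0) ∧ v ∈ E.smooth := by
  simp only [mem_smooth, mem_level_induced, forall_and, forall_const]

/-- A closed subspace `A` of `E` is an sc-subspace as soon as its smooth points are dense in each
`A ∩ E_m`: completeness and compactness of the levels are inherited. -/
theorem IsBanachScale.isScSubspace (hE : E.IsBanachScale) {A : Submodule ℝ (E.Level 0)}
    (hA : IsClosed (A : Set (E.Level 0)))
    (hdense : ∀ (m : ℕ) (x : E.Level m), E.incl (Nat.zero_le m) x ∈ A →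
      x ∈ closure {y : E.Level m | E.incl (Nat.zero_le m) y ∈ A ∧ E.toAmbient m y ∈ E.smooth}) :
    E.IsScSubspace A := by
  have hcl : ∀ m, IsClosed (Set.range (E.inducedIncl A m)) := fun m => by
    rw [range_inducedIncl]
    exact hA.preimage (hE.continuous_incl _)
  have hemb : ∀ m, Topology.IsClosedEmbedding (E.inducedIncl A m) := fun m =>
    ⟨(E.inducedIncl A m).isometry.isEmbedding, hcl m⟩
  refine ⟨hA, ⟨fun m => ?_, fun m => ?_, fun m => ?_⟩⟩
  · have := hE.banach_levels m
    exact (completeSpace_iff_isComplete_range (E.inducedIncl A m).isometry.isUniformInducing).2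
      (hcl m).isComplete
  · obtain ⟨K, hK, hmem⟩ := (hE.compactness m).comp_clm
      (E.inducedIncl A (m + 1)).toContinuousLinearMap
    exact ⟨E.inducedIncl A m ⁻¹' K, (hemb m).isCompact_preimage hK, hmem⟩
  · intro x
    rw [(hemb m).isInducing.closure_eq_preimage_closure_image]
    refine closure_mono ?_ (hdense m (E.inducedIncl A m x) ?_)
    · rintro y ⟨hy, hs⟩
      have hy' : y ∈ Set.range (E.inducedIncl A m) := by rwa [range_inducedIncl]
      obtain ⟨z, rfl⟩ := hy'
      exact ⟨z, mem_smooth_induced.2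
        ⟨(mem_level_induced.1 ((E.induced A).toAmbient_mem m z)).1, hs⟩, rfl⟩
    · have : E.inducedIncl A m x ∈ Set.range (E.inducedIncl A m) := ⟨x, rfl⟩
      rwa [range_inducedIncl] at this

/-! ### Splittings with a finite-dimensional summand -/

theorem IsScSplitting.symm {A B : Submodule ℝ (E.Level 0)} (h : E.IsScSplitting A B) :
    E.IsScSplitting B A :=
  ⟨h.right, h.left, fun m => inf_comm _ _ |>.trans (h.disjoint m),
    fun m => sup_comm _ _ |>.trans (h.sum m)⟩

theorem IsScSplitting.isCompl {A B : Submodule ℝ (E.Level 0)} (h : E.IsScSplitting A B) :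
    IsCompl A B := by
  refine ⟨Submodule.disjoint_def.2 fun x hA hB => ?_, Submodule.codisjoint_iff_exists_add_eq.2
    fun x => ?_⟩
  · have hx : E.toAmbient 0 x ∈ (E.induced A).level 0 ⊓ (E.induced B).level 0 :=
      ⟨⟨toAmbient_mem_map.2 hA, E.toAmbient_mem 0 x⟩, toAmbient_mem_map.2 hB, E.toAmbient_mem 0 x⟩
    rw [h.disjoint 0, Submodule.mem_bot] at hx
    exact E.toAmbient_injective 0 (hx.trans (map_zero _).symm)
  · have hx := E.toAmbient_mem 0 x
    rw [← h.sum 0, Submodule.mem_sup] at hx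
    obtain ⟨_, ⟨⟨a, ha, rfl⟩, -⟩, _, ⟨⟨b, hb, rfl⟩, -⟩, hab⟩ := hx
    exact ⟨a, b, ha, hb, E.toAmbient_injective 0 (by rw [map_add, hab])⟩

/-- A finite-dimensional space of smooth points and any closed complement of it form an
sc-splitting. The projection onto the finite-dimensional summand is continuous on every level and
takes smooth values, so the complementary projection maps smooth approximations in `E_m` to smooth
approximations in the closed complement. -/
theorem IsBanachScale.isScSplitting (hE : E.IsBanachScale) {N X : Submodule ℝ (E.Level 0)}
    [FiniteDimensional ℝ N] (hN : N.map (E.toAmbient 0) ≤ E.smooth)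
    (hX : IsClosed (X : Set (E.Level 0))) (hNX : IsCompl N X) : E.IsScSplitting N X := by
  have htop : Submodule.IsTopCompl N X :=
    (Submodule.IsCompl.isTopCompl_of_isClosed_of_finiteDimensional hNX.symm hX).symm
  have hsm : ∀ n ∈ N, E.toAmbient 0 n ∈ E.smooth := fun n hn => hN (toAmbient_mem_map.2 hn)
  refine ⟨hE.isScSubspace N.closed_of_finiteDimensional fun m x hx =>
      subset_closure ⟨hx, hsm _ hx⟩, hE.isScSubspace hX fun m x hx => ?_, fun m => ?_, fun m => ?_⟩
  · -- `j` is the inclusion of `N` in the level `E_m`, and `j ∘ p` the projection onto `N` there.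
    let j : N →ₗ[ℝ] E.Level m := LinearMap.codRestrict (E.level m) (E.toAmbient 0 ∘ₗ N.subtype)
      fun n => mem_smooth.1 (hsm n n.2) m
    let p : E.Level m → N := fun y => N.projectionOntoL X htop (E.incl (Nat.zero_le m) y)
    have hj : ∀ n, E.toAmbient m (j n) = E.toAmbient 0 n := fun _ => rfl
    have hcont : Continuous fun y => y - j (p y) :=
      continuous_id.sub (j.continuous_of_finiteDimensional.comp
        ((N.projectionOntoL X htop).continuous.comp (hE.continuous_incl _)))
    have hpx : p x = 0 := by
      simp only [p, Submodule.projectionOntoL_apply_eq_zero_iff]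
      exact hx
    have hmap := map_mem_closure hcont (hE.density m x)
      (t := {y : E.Level m | E.incl (Nat.zero_le m) y ∈ X ∧ E.toAmbient m y ∈ E.smooth})
      fun y hy => ?_
    · simpa only [hpx, map_zero, sub_zero] using hmap
    · constructor
      · have : E.incl (Nat.zero_le m) (j (p y)) = p y := rfl
        rw [map_sub, this, ← Submodule.projectionOntoL_apply_eq_zero_iff htop, map_sub,
          Submodule.projectionOntoL_apply_left]
        exact sub_self _
      · rw [map_sub, hj]
        exact E.smooth.sub_mem hy (hsm _ (p y).2)
  · rw [Submodule.eq_bot_iff]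
    rintro _ ⟨⟨⟨a, ha, rfl⟩, -⟩, ⟨b, hb, hba⟩, -⟩
    rw [E.toAmbient_injective 0 hba] at hb
    rw [Submodule.disjoint_def.1 hNX.disjoint a ha hb, map_zero]
  · refine le_antisymm (sup_le inf_le_right inf_le_right) fun w hw => ?_
    obtain ⟨x, rfl⟩ := exists_toAmbient_eq (E.level_le (Nat.zero_le m) hw)
    obtain ⟨n, y, hn, hy, rfl⟩ := Submodule.codisjoint_iff_exists_add_eq.1 hNX.codisjoint x
    have hnm := mem_smooth.1 (hsm n hn) m
    rw [map_add] at hw ⊢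
    exact Submodule.add_mem_sup ⟨toAmbient_mem_map.2 hn, hnm⟩
      ⟨toAmbient_mem_map.2 hy, (Submodule.add_mem_iff_right _ hnm).1 hw⟩

/-- A finite-dimensional sc-subspace consists of smooth points: these are dense in it, and a
linear subspace of a finite-dimensional space is closed. -/
theorem IsScSubspace.map_le_smooth {A : Submodule ℝ (E.Level 0)} [FiniteDimensional ℝ A]
    (hA : E.IsScSubspace A) : A.map (E.toAmbient 0) ≤ E.smooth := by
  let f : (E.induced A).Level 0 →ₗ[ℝ] A :=
    (E.inducedIncl A 0).toLinearMap.codRestrict A fun x => by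
      have h : E.inducedIncl A 0 x ∈ Set.range (E.inducedIncl A 0) := ⟨x, rfl⟩
      rwa [range_inducedIncl] at h
  have : FiniteDimensional ℝ ((E.induced A).Level 0) :=
    .of_injective f fun x y h => (E.inducedIncl A 0).injective congr(($h).val)
  let D := (E.induced A).smooth.comap ((E.induced A).toAmbient 0)
  have hD : (D : Set ((E.induced A).Level 0)) = Set.univ := by
    rw [← D.closed_of_finiteDimensional.closure_eq]
    exact (hA.2.density 0).closure_eq
  rintro _ ⟨a, ha, rfl⟩
  obtain ⟨x, hx⟩ := exists_toAmbient_eq (E := E.induced A) (m := 0)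
    (mem_level_induced.2 ⟨toAmbient_mem_map.2 ha, E.toAmbient_mem 0 a⟩)
  have hxD : x ∈ (D : Set ((E.induced A).Level 0)) := hD ▸ Set.mem_univ x
  rw [← hx]
  exact (mem_smooth_induced.1 hxD).2

/-- A closed subspace of finite codimension has a complement inside any dense subspace. -/
theorem _root_.Submodule.exists_isCompl_le_of_dense {X : Type*} [NormedAddCommGroup X]
    [NormedSpace ℝ X] {Y D : Submodule ℝ X} (hY : IsClosed (Y : Set X)) (hfin : Y.CoFG)
    (hD : Dense (D : Set X)) : ∃ C ≤ D, IsCompl Y C := by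
  have hsup : Y ⊔ D = ⊤ := by
    have hcl := Submodule.isClosed_mono_of_finiteDimensional_quotient hY (le_sup_left : Y ≤ Y ⊔ D)
    have hdense : Dense ((Y ⊔ D : Submodule ℝ X) : Set X) :=
      hD.mono (SetLike.coe_subset_coe.2 le_sup_right)
    exact SetLike.coe_injective (hcl.closure_eq.symm.trans hdense.closure_eq)
  obtain ⟨C, hC⟩ := (Y ⊓ D).exists_isCompl
  refine ⟨C ⊓ D, inf_le_right, ?_, ?_⟩
  · rw [disjoint_iff, ← inf_assoc, inf_right_comm, hC.inf_eq_bot]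
  · have hD' : Y ⊓ D ⊔ C ⊓ D = D := by
      rw [← sup_inf_assoc_of_le C (inf_le_right : Y ⊓ D ≤ D), hC.sup_eq_top, top_inf_eq]
    rw [codisjoint_iff, eq_top_iff, ← hsup]
    refine sup_le le_sup_left ?_
    nth_rw 1 [← hD']
    exact sup_le_sup_right inf_le_left _

/-! ### Sc-Fredholm operators as regularizing Fredholm operators -/

/-- An sc-operator that is Fredholm on the level zero and regularizing, in the sense that only
points of `E_m` are mapped into `F_m`, is sc-Fredholm. Its kernel consists of smooth points, its
range has a complement consisting of smooth points, and regularity says that the inverse of the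
induced bijection preserves levels. -/
theorem isScFredholm_of_regularizing (hE : E.IsBanachScale) (hF : F.IsBanachScale)
    {U : E.Level 0 →ₗ[ℝ] F.Level 0} (hU : IsScOperator U)
    (hker : FiniteDimensional ℝ (LinearMap.ker U))
    (hclosed : IsClosed (LinearMap.range U : Set (F.Level 0)))
    (hrange : (LinearMap.range U).CoFG)
    (hreg : ∀ (m : ℕ) (x : E.Level 0), F.toAmbient 0 (U x) ∈ F.level m →
      E.toAmbient 0 x ∈ E.level m) : IsScFredholm U := by
  have hKs : (LinearMap.ker U).map (E.toAmbient 0) ≤ E.smooth := by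
    rintro _ ⟨a, ha, rfl⟩
    refine mem_smooth.2 fun m => hreg m a ?_
    rw [LinearMap.mem_ker.1 ha, map_zero]
    exact zero_mem _
  obtain ⟨X, hXc, hX⟩ :=
    (Submodule.ClosedComplemented.of_finiteDimensional (LinearMap.ker U)).exists_isClosed_isCompl
  obtain ⟨C, hCs, hC⟩ := Submodule.exists_isCompl_le_of_dense
    (D := F.smooth.comap (F.toAmbient 0)) hclosed hrange (hF.density 0)
  have hCfin : FiniteDimensional ℝ C := .of_fg (hrange.fg_of_isCompl hC)
  have hXmem : ∀ x : (E.induced X).Level 0, E.inducedIncl X 0 x ∈ X := fun x =>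
    toAmbient_mem_map.1 (mem_level_induced.1 ((E.induced X).toAmbient_mem 0 x)).1
  let φ : (E.induced X).Level 0 →ₗ[ℝ] (F.induced (LinearMap.range U)).Level 0 :=
    LinearMap.codRestrict ((F.induced (LinearMap.range U)).level 0)
      (F.toAmbient 0 ∘ₗ U ∘ₗ (E.inducedIncl X 0).toLinearMap) fun x =>
        mem_level_induced.2 ⟨toAmbient_mem_map.2 ⟨_, rfl⟩, F.toAmbient_mem 0 _⟩
  have hφ : ∀ x, F.inducedIncl _ 0 (φ x) = U (E.inducedIncl X 0 x) := fun _ => rfl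
  have hφ' : ∀ x, (F.induced _).toAmbient 0 (φ x) = F.toAmbient 0 (U (E.inducedIncl X 0 x)) :=
    fun _ => rfl
  have hbij : Function.Bijective φ := by
    constructor
    · rw [injective_iff_map_eq_zero]
      intro x hx
      have h0 : U (E.inducedIncl X 0 x) = 0 := by rw [← hφ, hx, map_zero]
      exact (E.inducedIncl X 0).injective
        ((Submodule.disjoint_def.1 hX.disjoint _ h0 (hXmem x)).trans (map_zero _).symm)
    · intro y
      obtain ⟨_, ⟨a, rfl⟩, hy⟩ :=
        (mem_level_induced.1 ((F.induced (LinearMap.range U)).toAmbient_mem 0 y)).1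
      obtain ⟨k, x, hk, hx, rfl⟩ := Submodule.codisjoint_iff_exists_add_eq.1 hX.codisjoint a
      obtain ⟨z, hz⟩ := exists_toAmbient_eq (E := E.induced X) (m := 0)
        (mem_level_induced.2 ⟨toAmbient_mem_map.2 hx, E.toAmbient_mem 0 x⟩)
      have hz' : E.inducedIncl X 0 z = x := E.toAmbient_injective 0 hz
      refine ⟨z, (F.induced _).toAmbient_injective 0 ?_⟩
      rw [hφ', hz', ← hy, map_add, LinearMap.mem_ker.1 hk, zero_add]
  refine ⟨hU, LinearMap.ker U, X, LinearMap.range U, C, hE.isScSplitting hKs hXc hX,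
    (hF.isScSplitting (Submodule.map_le_iff_le_comap.2 hCs) hclosed hC.symm).symm,
    ⟨rfl, hker⟩, ⟨rfl, hCfin⟩, LinearEquiv.ofBijective φ hbij, ⟨?_, ?_⟩, ?_⟩
  · obtain ⟨hlev, hcont⟩ := hU
    refine ⟨fun m x hx => mem_level_induced.2
      ⟨toAmbient_mem_map.2 ⟨_, rfl⟩, hlev m _ (mem_level_induced.1 hx).2⟩, fun m => ?_⟩
    rw [(F.inducedIncl (LinearMap.range U) m).isometry.isEmbedding.continuous_iff]
    exact (hcont m).comp (E.inducedIncl X m).continuous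
  · intro m y hy
    obtain ⟨x, rfl⟩ := hbij.2 y
    have hx : (LinearEquiv.ofBijective φ hbij).symm (φ x) = x :=
      (LinearEquiv.ofBijective φ hbij).symm_apply_apply x
    change (E.induced X).toAmbient 0 ((LinearEquiv.ofBijective φ hbij).symm (φ x)) ∈ _
    rw [hx]
    exact mem_level_induced.2 ⟨toAmbient_mem_map.2 (hXmem x),
      hreg m _ (mem_level_induced.1 hy).2⟩
  · intro a x hax
    have : a = E.inducedIncl X 0 x := E.toAmbient_injective 0 hax
    rw [this]
    rfl

/-- An sc-Fredholm operator is regularizing. -/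
theorem IsScFredholm.mem_level {T : E.Level 0 →ₗ[ℝ] F.Level 0} (hT : IsScFredholm T) (m : ℕ)
    (x : E.Level 0) (hx : F.toAmbient 0 (T x) ∈ F.level m) : E.toAmbient 0 x ∈ E.level m := by
  obtain ⟨-, K, X, Y, C, hKX, -, ⟨rfl, hK⟩, ⟨rfl, -⟩, Φ, ⟨-, hΦ⟩, hTΦ⟩ := hT
  obtain ⟨k, y, hk, hy, rfl⟩ := Submodule.codisjoint_iff_exists_add_eq.1 hKX.isCompl.codisjoint x
  obtain ⟨z, hz⟩ := exists_toAmbient_eq (E := E.induced X) (m := 0)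
    (mem_level_induced.2 ⟨toAmbient_mem_map.2 hy, E.toAmbient_mem 0 y⟩)
  rw [map_add, LinearMap.mem_ker.1 hk, zero_add] at hx
  have hzm := hΦ m (Φ z) (mem_level_induced.2
    ⟨mem_level_induced.1 ((F.induced _).toAmbient_mem 0 _) |>.1, hTΦ y z hz.symm ▸ hx⟩)
  have hz' : Φ.symm.toLinearMap (Φ z) = z := Φ.symm_apply_apply z
  rw [hz', hz] at hzm
  rw [map_add]
  exact add_mem (mem_smooth.1 (hKX.left.map_le_smooth (toAmbient_mem_map.2 hk)) m)
    (mem_level_induced.1 hzm).2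

/-- The level-zero operator of an sc-operator as a continuous linear map. -/
def IsScOperator.toContinuousLinearMap {T : E.Level 0 →ₗ[ℝ] F.Level 0} (hT : IsScOperator T) :
    E.Level 0 →L[ℝ] F.Level 0 :=
  ⟨T, hT.2 0⟩

/-- The level-zero operator of an sc-Fredholm operator is Fredholm. -/
theorem IsScFredholm.isFredholm (hE : E.IsBanachScale) (hF : F.IsBanachScale)
    {T : E.Level 0 →ₗ[ℝ] F.Level 0} (hT : IsScFredholm T) :
    hT.1.toContinuousLinearMap.IsFredholm := by
  have := hE.banach_levels 0
  have := hF.banach_levels 0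
  obtain ⟨hsc, K, X, Y, C, -, hYC, ⟨rfl, hK⟩, ⟨rfl, hC⟩, -⟩ := hT
  exact .of_isClosed_range hK hYC.left.1
    ((Submodule.fg_iff_finiteDimensional C).2 hC |>.cofg_of_isCompl hYC.isCompl.symm)

/-! ### Sc⁺-operators -/

theorem IsScPlusOperator.mem_level_succ {S : E.Level 0 →ₗ[ℝ] F.Level 0} (hS : IsScPlusOperator S)
    {m : ℕ} {x : E.Level 0} (hx : E.toAmbient 0 x ∈ E.level m) :
    F.toAmbient 0 (S x) ∈ F.level (m + 1) := by
  obtain ⟨S', hS', hSS'⟩ := hS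
  rw [hSS', Nat.add_comm]
  exact hS'.1 m x hx

theorem IsScPlusOperator.isScOperator (hF : F.IsBanachScale) {S : E.Level 0 →ₗ[ℝ] F.Level 0}
    (hS : IsScPlusOperator S) : IsScOperator S := by
  refine ⟨fun m x hx => F.level_succ_le m (hS.mem_level_succ hx), fun m => ?_⟩
  obtain ⟨S', ⟨hlev, hcont⟩, hSS'⟩ := hS
  have h : Continuous fun x => F.incl (Nat.le_add_left m 1) (levelOperator S' hlev m x) :=
    (hF.continuous_incl _).comp (hcont m)
  convert h using 2 with x
  exact F.toAmbient_injective m (hSS' _)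

/-- An sc⁺-operator is compact on the level zero, since it factors through the compact inclusion
`F_1 → F_0`. -/
theorem IsScPlusOperator.isCompactOperator (hF : F.IsBanachScale)
    {S : E.Level 0 →ₗ[ℝ] F.Level 0} (hS : IsScPlusOperator S) : IsCompactOperator S := by
  obtain ⟨S', ⟨hlev, hcont⟩, hSS'⟩ := hS
  let s : E.Level 0 →L[ℝ] F.Level 1 := ⟨levelOperator S' hlev 0, hcont 0⟩
  have h : IsCompactOperator (F.incl (Nat.le_succ 0) ∘ s) := (hF.compactness 0).comp_clm s
  convert h using 1
  funext x
  exact F.toAmbient_injective 0 (hSS' x)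

theorem IsScOperator.add {T S : E.Level 0 →ₗ[ℝ] F.Level 0} (hT : IsScOperator T)
    (hS : IsScOperator S) : IsScOperator (T + S) :=
  ⟨fun m x hx => add_mem (hT.1 m x hx) (hS.1 m x hx), fun m => (hT.2 m).add (hS.2 m)⟩

end NormedScale

theorem proposition2p3 {V : Type*} [AddCommGroup V] [Module ℝ V]
    {W : Type*} [AddCommGroup W] [Module ℝ W]
    (E : NormedScale V) (hE : E.IsBanachScale) (F : NormedScale W) (hF : F.IsBanachScale)
    (T S : E.Level 0 →ₗ[ℝ] F.Level 0)
    (hT : NormedScale.IsScFredholm T) (hS : NormedScale.IsScPlusOperator S) :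
    NormedScale.IsScFredholm (T + S) ∧
      NormedScale.fredholmIndex (T + S) = NormedScale.fredholmIndex T := by
  have := hE.banach_levels 0
  have := hF.banach_levels 0
  have hSsc := hS.isScOperator hF
  have hS0 : IsCompactOperator hSsc.toContinuousLinearMap := hS.isCompactOperator hF
  obtain ⟨hfred, hindex⟩ := (hT.isFredholm hE hF).add_isCompactOperator hS0
  refine ⟨NormedScale.isScFredholm_of_regularizing hE hF (hT.1.add hSsc) hfred.finite_ker
    hfred.isClosed_range hfred.finite_coker fun m => ?_, hindex⟩
  -- Bootstrapping: if `x ∈ E_m`, then `S x` has one level more, and so has `T x = (T + S) x - S x`.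
  induction m with
  | zero => exact fun x _ => E.toAmbient_mem 0 x
  | succ m ih =>
    intro x hx
    refine hT.mem_level (m + 1) x ?_
    have hSx := hS.mem_level_succ (ih x (F.level_succ_le m hx))
    rw [LinearMap.add_apply, map_add] at hx
    exact (Submodule.add_mem_iff_left _ hSx).1 hx
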